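/- **Setting.** Let $E$ be a finite-dimensional real vector space, $E_{\mathbf C}=E\oplus iE$ its complexification, $V\subset E$ a linear subspace, $\nu=\dim V$, $dv$ a fixed Lebesgue measure on $V$. Let $l_1,\dots,l_m\in E^\vee=\mathrm{Hom}_{\mathbf R}(E,\mathbf R)$ be linearly independent linear forms (extended $\mathbf C$-linearly to $E_{\mathbf C}$), and let $B\subset E$ be an open convex neighbourhood of $0$ with $l_j(x)>-1$ for all $x\in B$ and all $j$. For $A\subset E$ write $T_A=A+iE\subset E_{\mathbf C}$. A function $c:V\to\mathbf R_{\ge 0}$ is called *sufficient* if (i) for every subspace $U\subset V$ and every $v\in V$ the function $u\mapsto c(v+u)$ is measurable on $U$ and $c_U(v)=\int_U c(v+u)\,du$ is finite ($du$ a Lebesgue measure on $U$), and (ii) for every subspace $U\subset V$ and every $v\in V\setminus U$ one has $\lim_{\tau\to\pm\infty}c_U(\tau v)=0$. A meromorphic function $f$ on $T_B$ is called *distinguished* with respect to $(V;l_1,\dots,l_m)$ if $$g(z)=f(z)\prod_{j=1}^m\frac{l_j(z)}{l_j(z)+1}$$ is holomorphic on $T_B$ and there is a sufficient function $c:V\to\mathbf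 R_{\ge0}$ such that for every compact $K\subset T_B$ there is a constant $\kappa(K)\ge 0$ with $|g(z+iv)|\le\kappa(K)\,c(v)$ for all $z\in K$ and $v\in V$. **Theorem 5.2.** Let $f$ be distinguished with respect to $(V;l_1,\dots,l_m)$, and let $C$ be a connected component of $B\setminus\bigcup_{j=1}^m\ker l_j$. Then for every $z\in T_C$ the integral $$\tilde f_C(z)=\frac1{(2\pi)^{\nu}}\int_V f(z+iv)\,dv$$ converges absolutely, and $\tilde f_C$ is holomorphic on $T_C$. Moreover, there are an open convex neighbourhood $\tilde B$ of $0$ in $E$ with $C\subset\tilde B$ and finitely many linear forms $\tilde l_1,\dots,\tilde l_{\tilde m}\in E^\vee$ vanishing on $V$ such that $$z\mapsto\tilde f_C(z)\prod_{j=1}^{\tilde m}\tilde l_j(z)$$ has a holomorphic continuation from $T_C$ to $T_{\tilde B}$, and such that $\ker(\tilde l_j)\cap C=\emptyset$ for all $j\in\{1,\dots,\tilde m\}$. -/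

import Mathlib

/-- The complexification `E_ℂ = E ⊕ iE` of a real vector space `E`; the pair `⟨x, y⟩`
stands for `x + i y`. -/
@[ext]
structure Complexification (E : Type*) where
  re : E
  im : E

namespace Complexification

section Algebra

variable {E : Type*} [AddCommGroup E]

/-- `x + i y ↦ (x, y)` -/
def equivProd (E : Type*) : Complexification E ≃ E × E where
  toFun z := (z.re, z.im)
  invFun p := ⟨p.1, p.2⟩
  left_inv _ := rfl
  right_inv _ := rfl

instance : AddCommGroup (Complexification E) := (equivProd E).addCommGroup

@[simp] theorem re_add (z w : Complexification E) : (z + w).re = z.re + w.re := rfl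
@[simp] theorem im_add (z w : Complexification E) : (z + w).im = z.im + w.im := rfl
@[simp] theorem re_zero : (0 : Complexification E).re = 0 := rfl
@[simp] theorem im_zero : (0 : Complexification E).im = 0 := rfl

variable [Module ℝ E]

/-- `(a + i b) (x + i y) = (a x - b y) + i (a y + b x)` -/
instance : SMul ℂ (Complexification E) where
  smul a z := ⟨a.re • z.re - a.im • z.im, a.re • z.im + a.im • z.re⟩

@[simp] theorem re_smul (a : ℂ) (z : Complexification E) :
    (a • z).re = a.re • z.re - a.im • z.im := rfl
@[simp] theorem im_smul (a : ℂ) (z : Complexification E) :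
    (a • z).im = a.re • z.im + a.im • z.re := rfl

instance : Module ℂ (Complexification E) where
  one_smul z := by ext <;> simp
  mul_smul a b z := by
    ext
    · simp only [re_smul, im_smul, Complex.mul_re, Complex.mul_im]; module
    · simp only [re_smul, im_smul, Complex.mul_re, Complex.mul_im]; module
  smul_zero a := by ext <;> simp
  smul_add a z w := by
    ext
    · simp only [re_smul, re_add, im_add]; module
    · simp only [im_smul, re_add, im_add]; module
  add_smul a b z := by
    ext
    · simp only [re_smul, re_add, Complex.add_re, Complex.add_im]; module
    · simp only [im_smul, im_add, Complex.add_re, Complex.add_im]; module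
  zero_smul z := by ext <;> simp

/-- The inclusion `E ⊆ E_ℂ`. -/
def ofReal (x : E) : Complexification E := ⟨x, 0⟩

/-- The `ℂ`-linear extension to `E_ℂ` of a real linear form: `l (x + i y) = l x + i l y`. -/
def extend (l : Module.Dual ℝ E) (z : Complexification E) : ℂ :=
  (l z.re : ℂ) + Complex.I * (l z.im : ℂ)

end Algebra

section Norm

variable {E : Type*} [NormedAddCommGroup E] [NormedSpace ℝ E]

/-- The `ℂ`-linear map from `E_ℂ` to the `ℝ`-linear maps `E^∨ → ℂ` given by
`x + i y ↦ (l ↦ l x + i l y)`. -/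
noncomputable def toHom : Complexification E →ₗ[ℂ] (StrongDual ℝ E →L[ℝ] ℂ) where
  toFun z :=
    Complex.ofRealCLM.comp (NormedSpace.inclusionInDoubleDual ℝ E z.re) +
      Complex.I • Complex.ofRealCLM.comp (NormedSpace.inclusionInDoubleDual ℝ E z.im)
  map_add' z w := by
    ext l
    simp
    ring
  map_smul' a z := by
    ext l
    apply Complex.ext
    · simp [sub_eq_add_neg]
    · simp [add_comm]

theorem toHom_apply (z : Complexification E) (l : StrongDual ℝ E) :
    toHom z l = (l z.re : ℂ) + Complex.I * (l z.im : ℂ) := by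
  simp [toHom]

theorem toHom_injective : Function.Injective (toHom (E := E)) := by
  intro z w h
  have key : ∀ l : StrongDual ℝ E, l z.re = l w.re ∧ l z.im = l w.im := by
    intro l
    have hl := congrArg (fun φ : StrongDual ℝ E →L[ℝ] ℂ => φ l) h
    simp only [toHom_apply] at hl
    constructor
    · simpa using congrArg Complex.re hl
    · simpa using congrArg Complex.im hl
  ext
  · exact SeparatingDual.eq_iff_forall_dual_eq.2 fun l => (key l).1
  · exact SeparatingDual.eq_iff_forall_dual_eq.2 fun l => (key l).2

/-- The norm `‖x + i y‖ = sup { |l x + i l y| : l ∈ E^∨, ‖l‖ ≤ 1 }` on `E_ℂ`; it induces the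
product topology of `E × E`. -/
noncomputable instance : NormedAddCommGroup (Complexification E) :=
  NormedAddCommGroup.induced (Complexification E) (StrongDual ℝ E →L[ℝ] ℂ) toHom toHom_injective

noncomputable instance : NormedSpace ℂ (Complexification E) :=
  NormedSpace.induced ℂ (Complexification E) (StrongDual ℝ E →L[ℝ] ℂ) toHom

end Norm

/-- The tube `T_B = B + iE` over a set `B ⊆ E`. -/
def tube {E : Type*} (B : Set E) : Set (Complexification E) := {z | z.re ∈ B}

end Complexification

open Complexification

/-- `f` represents a meromorphic function on the open set `U`: locally it is a quotient `p / q` of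
holomorphic functions, where the zero set of the denominator `q` has empty interior. The values
of `f` at the zeros of `q` play no role. -/
def IsMeromorphicOn {W : Type*} [NormedAddCommGroup W] [NormedSpace ℂ W]
    (f : W → ℂ) (U : Set W) : Prop :=
  ∀ z₀ ∈ U, ∃ O : Set W, IsOpen O ∧ z₀ ∈ O ∧ ∃ p q : W → ℂ,
    DifferentiableOn ℂ p O ∧ DifferentiableOn ℂ q O ∧
    interior {z ∈ O | q z = 0} = ∅ ∧
    ∀ z ∈ O, q z ≠ 0 → f z = p z / q z

/-- A sufficient function `c : V → ℝ_{≥ 0}` on a finite dimensional real vector space `V`.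
A Lebesgue measure on a subspace `U` is a Haar measure on it, unique up to a positive factor, so
that the two conditions do not depend on its choice. -/
structure IsSufficient {V : Type*} [NormedAddCommGroup V] [NormedSpace ℝ V]
    [MeasurableSpace V] [BorelSpace V] (c : V → ℝ) : Prop where
  nonneg : ∀ v, 0 ≤ c v
  integrable : ∀ (U : Submodule ℝ V) (ν : MeasureTheory.Measure U) [ν.IsAddHaarMeasure] (v : V),
    MeasureTheory.Integrable (fun u : U => c (v + u)) ν
  tendsto : ∀ (U : Submodule ℝ V) (ν : MeasureTheory.Measure U) [ν.IsAddHaarMeasure] (v : V),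
    v ∉ U →
    Filter.Tendsto (fun t : ℝ => ∫ u : U, c (t • v + u) ∂ν) Filter.atTop (nhds 0) ∧
    Filter.Tendsto (fun t : ℝ => ∫ u : U, c (t • v + u) ∂ν) Filter.atBot (nhds 0)

/-- `f`, meromorphic on the tube `T_B`, is distinguished with respect to `(V; l₁, …, l_m)`.
The function `g = f ∏ l_j / (l_j + 1)` is given by this formula off the hyperplanes `l_j = 0`,
where `f` may have poles, and is holomorphic on all of `T_B`. -/
def IsDistinguished {E : Type*} [NormedAddCommGroup E] [NormedSpace ℝ E]
    [MeasurableSpace E] [BorelSpace E]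
    (B : Set E) (V : Submodule ℝ E) {m : ℕ} (l : Fin m → Module.Dual ℝ E)
    (f : Complexification E → ℂ) : Prop :=
  IsMeromorphicOn f (tube B) ∧
  ∃ g : Complexification E → ℂ,
    DifferentiableOn ℂ g (tube B) ∧
    (∀ z ∈ tube B, (∀ j, extend (l j) z ≠ 0) →
      g z = f z * ∏ j, extend (l j) z / (extend (l j) z + 1)) ∧
    ∃ c : V → ℝ, IsSufficient c ∧
      ∀ K : Set (Complexification E), IsCompact K → K ⊆ tube B →
        ∃ κ : ℝ, 0 ≤ κ ∧ ∀ z ∈ K, ∀ v : V,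
          ‖g (z + Complex.I • ofReal (v : E))‖ ≤ κ * c v

/-- `C` is a connected component of `B - ⋃ ker l_j`. -/
def IsChamber {E : Type*} [NormedAddCommGroup E] [NormedSpace ℝ E]
    (B : Set E) {m : ℕ} (l : Fin m → Module.Dual ℝ E) (C : Set E) : Prop :=
  ∃ x ∈ B \ ⋃ j, {y | l j y = 0}, C = connectedComponentIn (B \ ⋃ j, {y | l j y = 0}) x

/-- The function `z ↦ (2π)^{-ν} ∫_V f(z + iv) dv`, `ν = dim V`, where `dv = μ` is a Lebesgue
measure on `V`. -/
noncomputable def tubeIntegral {E : Type*} [NormedAddCommGroup E] [NormedSpace ℝ E]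
    [MeasurableSpace E] (V : Submodule ℝ E) (μ : MeasureTheory.Measure V)
    (f : Complexification E → ℂ) (z : Complexification E) : ℂ :=
  1 / (2 * (Real.pi : ℂ)) ^ Module.finrank ℝ V * ∫ v : V, f (z + Complex.I • ofReal (v : E)) ∂μ

/-! On a chamber each `l j` has a constant sign `ε j`. Solving for `f` gives `g * ∏ (1 + 1 / l j)`,
and expanding this product writes `f` as a finite combination of terms `g / ∏_{j ∈ S} (ε j * l j)`
with all denominators of positive real part. Such terms inherit the bound of `g` by `c` along `iV`,
so their integrals over `V` converge absolutely and are holomorphic.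

The continuation across `0` goes by induction on `S`, through Gordan's alternative on `V`. If some
`v ∈ V` makes every form positive, the integral, being invariant under `iV` and holomorphic, is also
invariant under `V`; it extends to the tube over `D + V`, which contains `0`
(`hasContinuation_of_exists_pos`). Otherwise a nontrivial nonnegative combination of the forms
vanishes on `V`. It is positive on `D`, it can be pulled out of the integral, and multiplying by it
cancels one denominator in each summand (`hasContinuation_fiberIntegral`). These combinations are
the forms of the theorem. -/

section

open MeasureTheory hiding extend
open Filter Topology

/-! ### Linear and topological structure of the complexification. -/

section

namespace Complexification

variable {E : Type*} [NormedAddCommGroup E] [NormedSpace ℝ E]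

/-- The real part as a real linear map. -/
def reLinear (E : Type*) [NormedAddCommGroup E] [NormedSpace ℝ E] :
    Complexification E →ₗ[ℝ] E where
  toFun z := z.re
  map_add' _ _ := rfl
  map_smul' a z := (re_smul (a : ℂ) z).trans (by simp)

/-- The inclusion `E ⊆ E_ℂ` as a real linear map. -/
def ofRealLinear (E : Type*) [NormedAddCommGroup E] [NormedSpace ℝ E] :
    E →ₗ[ℝ] Complexification E where
  toFun x := ofReal x
  map_add' x y := by ext <;> simp [ofReal]
  map_smul' a z := by
    rw [← Complex.coe_smul]
    ext
    · exact ((re_smul (a : ℂ) (ofReal z)).trans (by simp [ofReal])).symm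
    · exact ((im_smul (a : ℂ) (ofReal z)).trans (by simp [ofReal])).symm

/-- The complex linear extension of a real linear form as a complex linear map. -/
def extendLinear (l : Module.Dual ℝ E) : Complexification E →ₗ[ℂ] ℂ where
  toFun z := extend l z
  map_add' z w := by simp [extend]; ring
  map_smul' a z := by apply Complex.ext <;> simp [extend, sub_eq_add_neg]

theorem extend_add (l : Module.Dual ℝ E) (z w : Complexification E) :
    extend l (z + w) = extend l z + extend l w := (extendLinear l).map_add z w

theorem extend_ofReal (l : Module.Dual ℝ E) (x : E) : extend l (ofReal x) = l x := by
  simp [extend, ofReal]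

theorem extend_smul (l : Module.Dual ℝ E) (a : ℂ) (z : Complexification E) :
    extend l (a • z) = a * extend l z := (extendLinear l).map_smul a z

theorem re_extend (l : Module.Dual ℝ E) (z : Complexification E) : (extend l z).re = l z.re := by
  simp [extend]

theorem extend_ne_zero {l : Module.Dual ℝ E} {z : Complexification E} (h : l z.re ≠ 0) :
    extend l z ≠ 0 := fun h0 => h (by rw [← re_extend, h0, Complex.zero_re])

theorem re_add_I_smul_ofReal (z : Complexification E) (x : E) :
    (z + Complex.I • ofReal x).re = z.re := by
  simp [ofReal]

theorem ofReal_add (x y : E) : ofReal (x + y) = ofReal x + ofReal y :=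
  (ofRealLinear E).map_add x y

variable [FiniteDimensional ℝ E]

instance : FiniteDimensional ℝ (Complexification E) :=
  FiniteDimensional.of_surjective
    ((ofRealLinear E).coprod ((LinearMap.lsmul ℂ (Complexification E) Complex.I).restrictScalars ℝ
      ∘ₗ ofRealLinear E)) fun z => ⟨(z.re, z.im), by
        ext <;> simp [ofRealLinear, ofReal]⟩

instance : FiniteDimensional ℂ (Complexification E) := FiniteDimensional.right ℝ ℂ _

instance : ProperSpace (Complexification E) := FiniteDimensional.proper ℂ _

theorem continuous_re : Continuous (re : Complexification E → E) :=
  (reLinear E).continuous_of_finiteDimensional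

theorem continuous_ofReal : Continuous (ofReal : E → Complexification E) :=
  (ofRealLinear E).continuous_of_finiteDimensional

theorem continuous_add_I_smul_ofReal (z : Complexification E) :
    Continuous fun x : E => z + Complex.I • ofReal x := by
  have h : Continuous fun x : E => Complex.I • ofReal x :=
    (continuous_const_smul Complex.I).comp continuous_ofReal
  exact continuous_const.add h

theorem differentiable_extend (l : Module.Dual ℝ E) : Differentiable ℂ (extend l) :=
  (extendLinear l).toContinuousLinearMap.differentiable

theorem isOpen_tube {B : Set E} (hB : IsOpen B) : IsOpen (tube B) := hB.preimage continuous_re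

end Complexification

/-! ### A theorem of the alternative. -/

/-- Gordan's alternative for finitely many linear forms. -/
theorem gordan_alternative {V ι : Type*} [AddCommGroup V] [Module ℝ V] (S : Finset ι)
    (φ : ι → V →ₗ[ℝ] ℝ) :
    (∃ v, ∀ j ∈ S, 0 < φ j v) ∨
      ∃ a : ι → ℝ, (∀ j ∈ S, 0 ≤ a j) ∧ (∃ j ∈ S, 0 < a j) ∧
        ∀ v, ∑ j ∈ S, a j * φ j v = 0 := by
  classical
  by_cases h : ∃ v, ∀ j ∈ S, 0 < φ j v
  · exact Or.inl h
  right
  let T : V →ₗ[ℝ] (S → ℝ) := LinearMap.pi fun j => φ j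
  have hopen : IsOpen (Set.univ.pi fun _ : S => Set.Ioi (0 : ℝ)) :=
    isOpen_set_pi Set.finite_univ fun _ _ => isOpen_Ioi
  -- The range of `T` misses the open positive orthant; the coefficients `a` come from a separating
  -- functional.
  obtain ⟨f, u, hf, hu⟩ := geometric_hahn_banach_open
    (s := Set.univ.pi fun _ : S => Set.Ioi (0 : ℝ)) (t := (T.range : Set (S → ℝ)))
    (convex_pi fun _ _ => convex_Ioi 0) hopen T.range.convex (by
      rw [Set.disjoint_left]
      rintro x hx ⟨v, rfl⟩
      exact h ⟨v, fun j hj => hx ⟨j, hj⟩ trivial⟩)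
  have hu0 : u ≤ 0 := by simpa using hu 0 T.range.zero_mem
  -- A functional bounded below on a subspace vanishes there: otherwise it would take the value `u -
  -- 1`.
  have hT : ∀ v, f (T v) = 0 := by
    intro v
    by_contra hne
    have h1 := hu (T (((u - 1) / f (T v)) • v)) ⟨_, rfl⟩
    rw [map_smul, map_smul, smul_eq_mul, div_mul_cancel₀ _ hne] at h1
    linarith
  have hexp : ∀ x : S → ℝ, f x = ∑ j, x j * f (Pi.single j 1) := by
    intro x
    conv_lhs => rw [pi_eq_sum_univ' x]
    simp [map_sum]
  have hneg : ∀ j, f (Pi.single j 1) ≤ 0 := by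
    intro j
    have hcl : (Pi.single j 1 : S → ℝ) ∈ closure (Set.univ.pi fun _ : S => Set.Ioi (0 : ℝ)) := by
      rw [closure_pi_set]
      intro i _
      rw [closure_Ioi]
      by_cases hij : i = j
      · subst hij; simp
      · simp [hij]
    exact closure_minimal (fun x hx => ((hf x hx).le.trans hu0 : f x ≤ 0))
      (isClosed_le f.continuous continuous_const) hcl
  refine ⟨fun j => if hj : j ∈ S then - f (Pi.single ⟨j, hj⟩ 1) else 0, ?_, ?_, ?_⟩
  · intro j hj
    simpa [hj] using hneg ⟨j, hj⟩
  -- If all coefficients vanished, `f` would be `0`, yet `f < u ≤ 0` at the all-ones vector.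
  · by_contra! hcon
    have h1 := hf (fun _ => 1) (fun _ _ => by simp)
    rw [hexp] at h1
    have : ∀ j : S, f (Pi.single j 1) = 0 := fun j => by
      have := hcon j j.2
      simp only [j.2, dite_true] at this
      exact le_antisymm (hneg j) (by linarith)
    simp [this] at h1
    linarith
  · intro v
    have h1 := hT v
    rw [hexp, ← Finset.sum_attach S] at *
    rw [← neg_eq_zero, ← Finset.sum_neg_distrib]
    refine Eq.trans (Finset.sum_congr rfl fun j _ => ?_) h1
    simp [T, mul_comm]

end

/-! ### Dominated functions and their fibre integrals. -/

section

variable {E : Type*} [NormedAddCommGroup E] [NormedSpace ℝ E]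

/-- `h` is holomorphic on the tube `T_D`, and locally uniformly dominated by `c` along `iV`. -/
def IsDominated (V : Submodule ℝ E) (c : V → ℝ) (D : Set E) (h : Complexification E → ℂ) : Prop :=
  DifferentiableOn ℂ h (tube D) ∧
    ∀ K : Set (Complexification E), IsCompact K → K ⊆ tube D →
      ∃ κ : ℝ, 0 ≤ κ ∧ ∀ z ∈ K, ∀ v : V, ‖h (z + Complex.I • ofReal (v : E))‖ ≤ κ * c v

/-- The integral `∫_V h (z + iv) dv`. -/
noncomputable def fiberIntegral [MeasurableSpace E] (V : Submodule ℝ E) (μ : Measure V)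
    (h : Complexification E → ℂ) (z : Complexification E) : ℂ :=
  ∫ v : V, h (z + Complex.I • ofReal (v : E)) ∂μ

namespace IsDominated

variable {V : Submodule ℝ E} {c : V → ℝ} {D : Set E} {h : Complexification E → ℂ}

theorem mono {D' : Set E} (hh : IsDominated V c D h) (hD : D' ⊆ D) : IsDominated V c D' h :=
  ⟨hh.1.mono fun _ hz => hD hz, fun K hK hKD => hh.2 K hK (hKD.trans fun _ hz => hD hz)⟩

theorem add_mem_tube {z : Complexification E} (hz : z ∈ tube D) (v : E) :
    z + Complex.I • ofReal v ∈ tube D := by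
  simpa only [tube, Set.mem_ofPred_eq, re_add_I_smul_ofReal] using hz

variable [FiniteDimensional ℝ E]

/-- Multiplication by the inverse of a linear form preserves domination where the real part
of the form is positive. -/
theorem mul_inv_extend (hh : IsDominated V c D h) (hc : ∀ v, 0 ≤ c v) {l : Module.Dual ℝ E}
    (hl : ∀ x ∈ D, 0 < l x) : IsDominated V c D fun z => h z * (extend l z)⁻¹ := by
  refine ⟨hh.1.mul ((differentiable_extend l).differentiableOn.inv fun z hz =>
    extend_ne_zero (hl _ hz).ne'), fun K hK hKD => ?_⟩
  obtain ⟨κ, hκ, hb⟩ := hh.2 K hK hKD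
  have hcont : ContinuousOn (fun z : Complexification E => (l z.re)⁻¹) K :=
    ContinuousOn.inv₀ (l.continuous_of_finiteDimensional.comp continuous_re).continuousOn
      fun z hz => (hl _ (hKD hz)).ne'
  obtain ⟨M, hM⟩ := (hK.image_of_continuousOn hcont).bddAbove
  refine ⟨κ * max M 0, by positivity, fun z hz v => ?_⟩
  have hpos : 0 < l z.re := hl _ (hKD hz)
  -- The modulus of the form is at least its real part `l z.re`, which does not change along `iV`
  -- and is bounded away from `0` on `K`.
  have h1 : ‖(extend l (z + Complex.I • ofReal (v : E)))⁻¹‖ ≤ max M 0 := by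
    refine le_trans ?_ ((hM ⟨z, hz, rfl⟩).trans (le_max_left _ _))
    rw [norm_inv]
    refine inv_anti₀ hpos (le_trans ?_ (Complex.re_le_norm _))
    rw [re_extend, re_add_I_smul_ofReal]
  rw [norm_mul, mul_right_comm]
  exact mul_le_mul (hb z hz v) h1 (norm_nonneg _) (mul_nonneg hκ (hc v))

theorem mul_prod_inv_extend {ι : Type*} (hh : IsDominated V c D h) (hc : ∀ v, 0 ≤ c v)
    {l : ι → Module.Dual ℝ E} (S : Finset ι) (hl : ∀ x ∈ D, ∀ j ∈ S, 0 < l j x) :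
    IsDominated V c D fun z => h z * ∏ j ∈ S, (extend (l j) z)⁻¹ := by
  classical
  induction S using Finset.induction_on with
  | empty => simpa using hh
  | insert j S hj ih =>
    have h1 := (ih fun x hx i hi => hl x hx i (Finset.mem_insert_of_mem hi)).mul_inv_extend hc
      (l := l j) fun x hx => hl x hx j (Finset.mem_insert_self _ _)
    simpa only [Finset.prod_insert hj, mul_assoc, mul_comm (extend (l j) _)⁻¹] using h1

theorem hasFDerivAt_comp (hh : IsDominated V c D h) (hD : IsOpen D)
    {z : Complexification E} (hz : z ∈ tube D) (v : E) :
    HasFDerivAt (fun w => h (w + Complex.I • ofReal v))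
      (fderiv ℂ h (z + Complex.I • ofReal v)) z := by
  rw [hasFDerivAt_comp_add_right]
  exact (hh.1.differentiableAt ((isOpen_tube hD).mem_nhds (add_mem_tube hz v))).hasFDerivAt

variable [MeasurableSpace E] [BorelSpace E] {μ : Measure V}

theorem aestronglyMeasurable (hh : IsDominated V c D h)
    {z : Complexification E} (hz : z ∈ tube D) :
    AEStronglyMeasurable (fun v : V => h (z + Complex.I • ofReal (v : E))) μ := by
  refine Continuous.aestronglyMeasurable ?_
  refine hh.1.continuousOn.comp_continuous ?_ fun v => add_mem_tube hz _
  exact (continuous_add_I_smul_ofReal z).comp continuous_subtype_val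

theorem integrable (hh : IsDominated V c D h) (hc : Integrable c μ)
    {z : Complexification E} (hz : z ∈ tube D) :
    Integrable (fun v : V => h (z + Complex.I • ofReal (v : E))) μ := by
  obtain ⟨κ, -, hb⟩ := hh.2 {z} isCompact_singleton (by simpa using hz)
  exact (hc.const_mul κ).mono' (hh.aestronglyMeasurable hz)
    (ae_of_all _ fun v => hb z rfl v)

/-- Differentiation under the integral sign: a Cauchy-type estimate turns the bound on `h` into an
integrable bound on its derivative. -/
theorem differentiableOn_fiberIntegral (hh : IsDominated V c D h) (hc : Integrable c μ)
    (hD : IsOpen D) : DifferentiableOn ℂ (fiberIntegral V μ h) (tube D) := by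
  intro z₀ hz₀
  obtain ⟨r, hr, hball⟩ := Metric.isOpen_iff.1 (isOpen_tube hD) z₀ hz₀
  have hK : Metric.closedBall z₀ (r / 2) ⊆ tube D :=
    (Metric.closedBall_subset_ball (by linarith)).trans hball
  obtain ⟨κ, hκ, hb⟩ := hh.2 _ (isCompact_closedBall z₀ (r / 2)) hK
  have hmeas : AEStronglyMeasurable
      (fun v : V => fderiv ℂ h (z₀ + Complex.I • ofReal (v : E))) μ := by
    borelize (Complexification E)
    have hcont : Continuous fun v : V => z₀ + Complex.I • ofReal (v : E) :=
      (continuous_add_I_smul_ofReal z₀).comp continuous_subtype_val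
    borelize (Complexification E →L[ℂ] ℂ)
    exact ((measurable_fderiv ℂ h).comp hcont.measurable).aestronglyMeasurable
  refine (hasFDerivAt_integral_of_dominated_of_fderiv_le (𝕜 := ℂ)
    (F := fun z (v : V) => h (z + Complex.I • ofReal (v : E)))
    (F' := fun z (v : V) => fderiv ℂ h (z + Complex.I • ofReal (v : E)))
    -- For `z` within `r / 4` of `z₀`, the ball of radius `r / 4` about `z` stays where `‖h‖ ≤ κ * c
    -- v` on the translate by `iv`, so there `h` varies by at most twice that.
    (bound := fun v => 2 * (κ * c v) / (r / 4))
    (Metric.ball_mem_nhds z₀ (show 0 < r / 4 by linarith)) ?_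
    (hh.integrable hc hz₀) hmeas (ae_of_all _ fun v z hz => ?_)
    (((hc.const_mul κ).const_mul 2).div_const _)
    (ae_of_all _ fun v z hz => ?_)).differentiableAt.differentiableWithinAt
  · filter_upwards [(isOpen_tube hD).mem_nhds hz₀] with z hz
    exact hh.aestronglyMeasurable hz
  · have hsub : ∀ w ∈ Metric.ball z (r / 4), w ∈ Metric.closedBall z₀ (r / 2) := by
      intro w hw
      rw [Metric.mem_ball] at hw hz
      have := dist_triangle w z z₀
      rw [Metric.mem_closedBall]
      linarith
    have hzz := hsub z (Metric.mem_ball_self (by linarith))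
    rw [← fderiv_comp_add_right]
    refine Complex.norm_fderiv_le_div_of_mapsTo_ball (fun w hw =>
      (hh.hasFDerivAt_comp hD (hK (hsub w hw)) v).differentiableAt.differentiableWithinAt)
      (fun w hw => ?_) (by linarith)
    rw [Metric.mem_closedBall, dist_eq_norm]
    refine (norm_sub_le _ _).trans ?_
    linarith [hb w (hsub w hw) v, hb z hzz v]
  · refine hh.hasFDerivAt_comp hD (hK ?_) v
    exact Metric.ball_subset_closedBall (Metric.ball_subset_ball (by linarith) hz)

end IsDominated

theorem fiberIntegral_add_I_smul [MeasurableSpace E] [BorelSpace E] [FiniteDimensional ℝ E]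
    (V : Submodule ℝ E) (μ : Measure V)
    [μ.IsAddHaarMeasure] (h : Complexification E → ℂ) (z : Complexification E) (v : V) :
    fiberIntegral V μ h (z + Complex.I • ofReal (v : E)) = fiberIntegral V μ h z := by
  unfold fiberIntegral
  rw [← integral_add_left_eq_self (fun u : V => h (z + Complex.I • ofReal (u : E))) v]
  simp [ofReal_add, add_assoc]

namespace IsDominated

variable [FiniteDimensional ℝ E] [MeasurableSpace E] [BorelSpace E]
  {V : Submodule ℝ E} {μ : Measure V} [μ.IsAddHaarMeasure]
  {c : V → ℝ} {D : Set E} {h : Complexification E → ℂ}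

/-- The fibre integral is invariant under `iV`, hence, by the Cauchy-Riemann equations,
under `V` as long as the path stays inside a convex tube. -/
theorem fiberIntegral_add_ofReal (hh : IsDominated V c D h) (hc : Integrable c μ)
    (hD : IsOpen D) (hconv : Convex ℝ D) {z : Complexification E} (hz : z ∈ tube D)
    {v : E} (hv : v ∈ V) (hzv : z.re + v ∈ D) :
    fiberIntegral V μ h (z + ofReal v) = fiberIntegral V μ h z := by
  have hdiff : ∀ w ∈ tube D, HasFDerivAt (fiberIntegral V μ h)
      (fderiv ℂ (fiberIntegral V μ h) w) w := fun w hw =>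
    ((hh.differentiableOn_fiberIntegral hc hD).differentiableAt
      ((isOpen_tube hD).mem_nhds hw)).hasFDerivAt
  -- The derivative is complex linear and vanishes in the direction `iv`, where the integral is
  -- constant.
  have hzero : ∀ w ∈ tube D, fderiv ℂ (fiberIntegral V μ h) w (ofReal v) = 0 := by
    intro w hw
    have hline : HasDerivAt (fun t : ℝ => w + t • (Complex.I • ofReal v))
        (Complex.I • ofReal v) 0 := by
      simpa using ((hasDerivAt_id (0 : ℝ)).smul_const (Complex.I • ofReal v)).const_add w
    have h1 := HasFDerivAt.comp_hasDerivAt (0 : ℝ)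
      (show HasFDerivAt (fiberIntegral V μ h)
        ((fderiv ℂ (fiberIntegral V μ h) w).restrictScalars ℝ)
        (w + (0 : ℝ) • (Complex.I • ofReal v)) by
        simpa using (hdiff w hw).restrictScalars ℝ) hline
    have h2 : (fiberIntegral V μ h ∘ fun t : ℝ => w + t • (Complex.I • ofReal v)) =
        fun _ => fiberIntegral V μ h w := by
      funext t
      have := fiberIntegral_add_I_smul V μ h w ⟨t • v, V.smul_mem t hv⟩
      rw [← this, Function.comp_apply, smul_comm]
      congr 3
      exact ((ofRealLinear E).map_smul t v).symm
    rw [h2] at h1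
    have h3 := h1.unique (hasDerivAt_const _ _)
    simpa using h3
  have hseg : ∀ t ∈ Set.Icc (0 : ℝ) 1, z + t • ofReal v ∈ tube D := by
    intro t ht
    have : (z + t • ofReal v).re = z.re + t • v :=
      congrArg (z.re + ·) ((reLinear E).map_smul t (ofReal v))
    show (z + t • ofReal v).re ∈ D
    rw [this]
    exact hconv.add_smul_mem hz hzv ht
  have hpath : ∀ t ∈ Set.Icc (0 : ℝ) 1,
      HasDerivAt (fun t : ℝ => fiberIntegral V μ h (z + t • ofReal v)) 0 t := by
    intro t ht
    have hline : HasDerivAt (fun t : ℝ => z + t • ofReal v) (ofReal v) t := by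
      simpa using ((hasDerivAt_id t).smul_const (ofReal v)).const_add z
    have h1 := HasFDerivAt.comp_hasDerivAt t
      ((hdiff _ (hseg t ht)).restrictScalars ℝ) hline
    rw [ContinuousLinearMap.coe_restrictScalars', hzero _ (hseg t ht)] at h1
    exact h1
  have := constant_of_has_deriv_right_zero
    (f := fun t : ℝ => fiberIntegral V μ h (z + t • ofReal v)) (a := 0) (b := 1)
    (fun t ht => (hpath t ht).continuousAt.continuousWithinAt)
    (fun t ht => (hpath t (Set.Ico_subset_Icc_self ht)).hasDerivWithinAt) 1 (by simp)
  simpa using this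

/-- The fibre integral extends holomorphically to the tube over `D + V`. -/
theorem exists_extension_add (hh : IsDominated V c D h) (hc : Integrable c μ)
    (hD : IsOpen D) (hconv : Convex ℝ D) :
    ∃ F : Complexification E → ℂ, DifferentiableOn ℂ F (tube {x | ∃ v ∈ V, x + v ∈ D}) ∧
      ∀ z ∈ tube D, F z = fiberIntegral V μ h z := by
  classical
  let F : Complexification E → ℂ := fun z =>
    if hz : ∃ v ∈ V, z.re + v ∈ D then fiberIntegral V μ h (z + ofReal hz.choose) else 0
  -- The chosen shift is immaterial: two admissible shifts differ by an element of `V`, and both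
  -- shifted points lie over the convex set `D`. Near a given point one fixed shift therefore
  -- serves.
  have hF : ∀ z : Complexification E, ∀ v ∈ V, z.re + v ∈ D →
      F z = fiberIntegral V μ h (z + ofReal v) := by
    intro z v hv hzv
    have hz : ∃ v ∈ V, z.re + v ∈ D := ⟨v, hv, hzv⟩
    have h1 := hh.fiberIntegral_add_ofReal hc hD hconv (z := z + ofReal v)
      (v := hz.choose - v) hzv (V.sub_mem hz.choose_spec.1 hv) (by
        simpa [ofReal] using hz.choose_spec.2)
    rw [add_assoc, ← ofReal_add, add_sub_cancel] at h1
    simp only [F, dif_pos hz, h1]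
  refine ⟨F, fun z₀ hz₀ => ?_, fun z hz => ?_⟩
  · obtain ⟨v, hv, hzv⟩ := hz₀
    have hd : DifferentiableAt ℂ (fun z => fiberIntegral V μ h (z + ofReal v)) z₀ := by
      rw [differentiableAt_comp_add_right]
      exact (hh.differentiableOn_fiberIntegral hc hD).differentiableAt
        ((isOpen_tube hD).mem_nhds hzv)
    refine (hd.congr_of_eventuallyEq ?_).differentiableWithinAt
    have hcont : Continuous fun z : Complexification E => z.re + v :=
      continuous_re.add continuous_const
    filter_upwards [(hD.preimage hcont).mem_nhds hzv] with z hz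
    exact hF z v hv hz
  · have := hF z 0 V.zero_mem (by rw [add_zero]; exact hz)
    rw [this, show ofReal (0 : E) = 0 from rfl, add_zero]

end IsDominated

end

/-! ### Continuation up to linear factors. -/

section

variable {E : Type*} [NormedAddCommGroup E] [NormedSpace ℝ E]

/-- `h`, multiplied by finitely many linear forms vanishing on `V` and without zeros on `C`, extends
holomorphically from `T_C` to the tube over an open convex neighbourhood of `0` containing `C`. -/
def HasContinuation (V : Submodule ℝ E) (C : Set E) (h : Complexification E → ℂ) : Prop :=
  ∃ B' : Set E, IsOpen B' ∧ Convex ℝ B' ∧ (0 : E) ∈ B' ∧ C ⊆ B' ∧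
    ∃ L : List (Module.Dual ℝ E),
      (∀ l ∈ L, ∀ v ∈ V, l v = 0) ∧ (∀ l ∈ L, ∀ x ∈ C, l x ≠ 0) ∧
      ∃ F : Complexification E → ℂ, DifferentiableOn ℂ F (tube B') ∧
        ∀ z ∈ tube C, F z = h z * (L.map fun l => extend l z).prod

namespace HasContinuation

variable {V : Submodule ℝ E} {C : Set E} {h h₁ h₂ : Complexification E → ℂ}

theorem congr (hh : HasContinuation V C h₁) (heq : ∀ z ∈ tube C, h₁ z = h₂ z) :
    HasContinuation V C h₂ := by
  obtain ⟨B', h1, h2, h3, h4, L, h5, h6, F, h7, h8⟩ := hh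
  exact ⟨B', h1, h2, h3, h4, L, h5, h6, F, h7, fun z hz => by rw [h8 z hz, heq z hz]⟩

theorem mono {C' : Set E} (hh : HasContinuation V C h) (hC : C' ⊆ C) : HasContinuation V C' h := by
  obtain ⟨B', h1, h2, h3, h4, L, h5, h6, F, h7, h8⟩ := hh
  exact ⟨B', h1, h2, h3, hC.trans h4, L, h5, fun l hl x hx => h6 l hl x (hC hx), F, h7,
    fun z hz => h8 z (hC hz)⟩

theorem zero : HasContinuation V C fun _ => 0 :=
  ⟨Set.univ, isOpen_univ, convex_univ, trivial, Set.subset_univ _, [], by simp, by simp,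
    fun _ => 0, differentiableOn_const _, by simp⟩

theorem const_mul (a : ℂ) (hh : HasContinuation V C h) :
    HasContinuation V C fun z => a * h z := by
  obtain ⟨B', h1, h2, h3, h4, L, h5, h6, F, h7, h8⟩ := hh
  exact ⟨B', h1, h2, h3, h4, L, h5, h6, fun z => a * F z, h7.const_mul a,
    fun z hz => by simp only [h8 z hz, mul_assoc]⟩

/-- A linear form vanishing on `V` without zeros on `C` may be cancelled. -/
theorem of_extend_mul {l : Module.Dual ℝ E} (hlV : ∀ v ∈ V, l v = 0) (hlC : ∀ x ∈ C, l x ≠ 0)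
    (hh : HasContinuation V C fun z => extend l z * h z) : HasContinuation V C h := by
  obtain ⟨B', h1, h2, h3, h4, L, h5, h6, F, h7, h8⟩ := hh
  refine ⟨B', h1, h2, h3, h4, l :: L, ?_, ?_, F, h7, fun z hz => ?_⟩
  · simpa using ⟨hlV, h5⟩
  · simpa using ⟨hlC, h6⟩
  · rw [h8 z hz, List.map_cons, List.prod_cons]
    ring

variable [FiniteDimensional ℝ E]

theorem differentiable_prod_extend (L : List (Module.Dual ℝ E)) :
    Differentiable ℂ fun z => (L.map fun l => extend l z).prod := by
  induction L with
  | nil => simp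
  | cons l L ih =>
    simp only [List.map_cons, List.prod_cons]
    exact (differentiable_extend l).fun_mul ih

/-- Common denominator: each summand is multiplied by the linear factors of the other. -/
theorem add (hh₁ : HasContinuation V C h₁) (hh₂ : HasContinuation V C h₂) :
    HasContinuation V C fun z => h₁ z + h₂ z := by
  obtain ⟨B₁, h1, h2, h3, h4, L₁, h5, h6, F₁, h7, h8⟩ := hh₁
  obtain ⟨B₂, k1, k2, k3, k4, L₂, k5, k6, F₂, k7, k8⟩ := hh₂
  refine ⟨B₁ ∩ B₂, h1.inter k1, h2.inter k2, ⟨h3, k3⟩, Set.subset_inter h4 k4, L₁ ++ L₂,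
    fun l hl => (List.mem_append.1 hl).elim (h5 l) (k5 l),
    fun l hl => (List.mem_append.1 hl).elim (h6 l) (k6 l),
    fun z => F₁ z * (L₂.map fun l => extend l z).prod + F₂ z * (L₁.map fun l => extend l z).prod,
    ?_, fun z hz => ?_⟩
  · exact ((h7.mono fun z hz => hz.1).mul (differentiable_prod_extend L₂).differentiableOn).add
      ((k7.mono fun z hz => hz.2).mul (differentiable_prod_extend L₁).differentiableOn)
  · simp only [h8 z hz, k8 z hz, List.map_append, List.prod_append]
    ring

theorem sum {ι : Type*} (S : Finset ι) {H : ι → Complexification E → ℂ}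
    (hH : ∀ j ∈ S, HasContinuation V C (H j)) : HasContinuation V C fun z => ∑ j ∈ S, H j z := by
  classical
  induction S using Finset.induction_on with
  | empty => simpa using zero
  | insert j S hj ih =>
    simp only [Finset.sum_insert hj]
    exact (hH j (Finset.mem_insert_self _ _)).add
      (ih fun i hi => hH i (Finset.mem_insert_of_mem hi))

end HasContinuation

/-- The cancellation behind the induction: each term of the sum removes one factor from the
denominator. -/
theorem sum_mul_prod_inv_eq {ι : Type*} [DecidableEq ι] (S : Finset ι) (a x : ι → ℂ)
    (hx : ∀ j ∈ S, x j ≠ 0) :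
    (∑ j ∈ S, a j * x j) * ∏ j ∈ S, (x j)⁻¹ = ∑ j ∈ S, a j * ∏ i ∈ S.erase j, (x i)⁻¹ := by
  rw [Finset.sum_mul]
  refine Finset.sum_congr rfl fun j hj => ?_
  rw [← Finset.mul_prod_erase S _ hj]
  have := hx j hj
  field_simp

theorem extend_sum_smul {ι : Type*} (S : Finset ι) (a : ι → ℝ) (l : ι → Module.Dual ℝ E)
    (z : Complexification E) :
    extend (∑ j ∈ S, a j • l j) z = ∑ j ∈ S, (a j : ℂ) * extend (l j) z := by
  simp [extend, Finset.mul_sum, ← Finset.sum_add_distrib]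
  exact Finset.sum_congr rfl fun j _ => by ring

theorem extend_add_I_smul_of_eq_zero {l : Module.Dual ℝ E} {v : E} (hv : l v = 0)
    (z : Complexification E) : extend l (z + Complex.I • ofReal v) = extend l z := by
  rw [extend_add, extend_smul, extend_ofReal, hv]
  simp

variable [FiniteDimensional ℝ E] [MeasurableSpace E] [BorelSpace E]
  {V : Submodule ℝ E} {μ : Measure V} [μ.IsAddHaarMeasure] {c : V → ℝ}

-- Such a form is constant along the fibres `z + iV`.
omit [FiniteDimensional ℝ E] [BorelSpace E] [μ.IsAddHaarMeasure] in
theorem fiberIntegral_mul_left {l : Module.Dual ℝ E} (hl : ∀ v ∈ V, l v = 0)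
    (h : Complexification E → ℂ) (z : Complexification E) :
    fiberIntegral V μ (fun z => extend l z * h z) z = extend l z * fiberIntegral V μ h z := by
  unfold fiberIntegral
  simp only [extend_add_I_smul_of_eq_zero (hl _ (Subtype.prop _))]
  exact integral_const_mul _ _

omit [μ.IsAddHaarMeasure] in
theorem fiberIntegral_sum {ι : Type*} {D : Set E} (S : Finset ι) (a : ι → ℂ)
    {H : ι → Complexification E → ℂ} (hH : ∀ j ∈ S, IsDominated V c D (H j))
    (hc : Integrable c μ) (hD : IsOpen D) {z : Complexification E} (hz : z ∈ tube D) :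
    fiberIntegral V μ (fun z => ∑ j ∈ S, a j * H j z) z =
      ∑ j ∈ S, a j * fiberIntegral V μ (H j) z := by
  unfold fiberIntegral
  rw [integral_finsetSum _ fun j hj => ((hH j hj).integrable hc hz).const_mul _]
  simp only [integral_const_mul]

omit [BorelSpace E] [FiniteDimensional ℝ E] [μ.IsAddHaarMeasure] in
theorem fiberIntegral_congr {D : Set E} {h₁ h₂ : Complexification E → ℂ}
    (h : ∀ z ∈ tube D, h₁ z = h₂ z) {z : Complexification E} (hz : z ∈ tube D) :
    fiberIntegral V μ h₁ z = fiberIntegral V μ h₂ z :=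
  integral_congr_ae (ae_of_all _ fun v => h _ (IsDominated.add_mem_tube hz v))

/-! ### Continuation across the origin. -/

omit [MeasurableSpace E] [BorelSpace E] in
theorem isOpen_setOf_forall_pos {ι : Type*} {B : Set E} (hB : IsOpen B) (l : ι → Module.Dual ℝ E)
    (S : Finset ι) : IsOpen {x | x ∈ B ∧ ∀ j ∈ S, 0 < l j x} := by
  have : {x | x ∈ B ∧ ∀ j ∈ S, 0 < l j x} = B ∩ ⋂ j ∈ S, {x | 0 < l j x} := by
    ext x; simp
  rw [this]
  exact hB.inter (isOpen_biInter_finset fun j _ =>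
    isOpen_lt continuous_const (l j).continuous_of_finiteDimensional)

omit [MeasurableSpace E] [BorelSpace E] [FiniteDimensional ℝ E] in
theorem convex_setOf_forall_pos {ι : Type*} {B : Set E} (hB : Convex ℝ B)
    (l : ι → Module.Dual ℝ E) (S : Finset ι) : Convex ℝ {x | x ∈ B ∧ ∀ j ∈ S, 0 < l j x} := by
  have : {x | x ∈ B ∧ ∀ j ∈ S, 0 < l j x} = B ∩ ⋂ j ∈ S, {x | 0 < l j x} := by
    ext x; simp
  rw [this]
  exact hB.inter (convex_iInter₂ fun j _ => convex_halfSpace_gt (l j).isLinear 0)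

/-- If some vector of `V` is positive under all the forms `l j`, `j ∈ S`, the integral of
`g / ∏ l j` extends holomorphically across `0`. -/
theorem hasContinuation_of_exists_pos {ι : Type*} {B : Set E} (hBo : IsOpen B) (hBc : Convex ℝ B)
    (hB0 : (0 : E) ∈ B) {g : Complexification E → ℂ} (hg : IsDominated V c B g)
    (hc0 : ∀ v, 0 ≤ c v) (hc : Integrable c μ) (l : ι → Module.Dual ℝ E) (S : Finset ι)
    {v : E} (hv : v ∈ V) (hpos : ∀ j ∈ S, 0 < l j v) :
    HasContinuation V {x | x ∈ B ∧ ∀ j ∈ S, 0 < l j x}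
      (fiberIntegral V μ fun z => g z * ∏ j ∈ S, (extend (l j) z)⁻¹) := by
  set D : Set E := {x | x ∈ B ∧ ∀ j ∈ S, 0 < l j x} with hD
  have hDo : IsOpen D := isOpen_setOf_forall_pos hBo l S
  have hDc : Convex ℝ D := convex_setOf_forall_pos hBc l S
  have hdom : IsDominated V c D fun z => g z * ∏ j ∈ S, (extend (l j) z)⁻¹ :=
    (hg.mono fun x hx => hx.1).mul_prod_inv_extend hc0 S fun x hx => hx.2
  obtain ⟨F, hF, hFD⟩ := hdom.exists_extension_add hc hDo hDc
  have hopen : IsOpen {x | ∃ v ∈ V, x + v ∈ D} := by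
    have : {x | ∃ v ∈ V, x + v ∈ D} = ⋃ v ∈ V, (fun x => x + v) ⁻¹' D := by ext x; simp
    rw [this]
    exact isOpen_biUnion fun v _ => hDo.preimage (continuous_add_const v)
  have hconv : Convex ℝ {x | ∃ v ∈ V, x + v ∈ D} := by
    rintro x ⟨v, hv, hxv⟩ y ⟨w, hw, hyw⟩ a b ha hb hab
    refine ⟨a • v + b • w, V.add_mem (V.smul_mem a hv) (V.smul_mem b hw), ?_⟩
    have := hDc hxv hyw ha hb hab
    rwa [smul_add, smul_add, add_add_add_comm] at this
  -- A small multiple `t • v` lies in `D`, which puts `0` in `D + V`.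
  have hsmall : ∃ t : ℝ, 0 < t ∧ t • v ∈ B := by
    have hcont : Tendsto (fun t : ℝ => t • v) (𝓝[>] 0) (𝓝 0) := by
      have : Tendsto (fun t : ℝ => t • v) (𝓝 0) (𝓝 ((0 : ℝ) • v)) :=
        (continuous_id.smul continuous_const).tendsto 0
      rw [zero_smul] at this
      exact this.mono_left nhdsWithin_le_nhds
    obtain ⟨t, ht, htB⟩ :=
      ((eventually_mem_nhdsWithin (a := (0 : ℝ)) (s := Set.Ioi 0)).and (hcont.eventually (hBo.mem_nhds hB0))).exists
    exact ⟨t, ht, htB⟩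
  obtain ⟨t, ht, htB⟩ := hsmall
  refine ⟨_, hopen, hconv, ⟨t • v, V.smul_mem t hv, ?_⟩, fun x hx => ⟨0, V.zero_mem, by simpa⟩, [],
    by simp, by simp, F, hF, fun z hz => by simp [hFD z hz]⟩
  rw [zero_add]
  exact ⟨htB, fun j hj => by rw [map_smul]; exact mul_pos ht (hpos j hj)⟩

/-- The integral of `g / ∏ l j` over `V` has a meromorphic continuation across `0`. -/
theorem hasContinuation_fiberIntegral {ι : Type*} {B : Set E} (hBo : IsOpen B)
    (hBc : Convex ℝ B) (hB0 : (0 : E) ∈ B) {g : Complexification E → ℂ}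
    (hg : IsDominated V c B g) (hc0 : ∀ v, 0 ≤ c v) (hc : Integrable c μ)
    (l : ι → Module.Dual ℝ E) (S : Finset ι) :
    HasContinuation V {x | x ∈ B ∧ ∀ j ∈ S, 0 < l j x}
      (fiberIntegral V μ fun z => g z * ∏ j ∈ S, (extend (l j) z)⁻¹) := by
  classical
  induction S using Finset.strongInduction with
  | H S ih =>
    -- The empty `S` always falls under the first alternative, so the induction needs no separate
    -- base case.
    rcases gordan_alternative S (fun j => l j ∘ₗ V.subtype) with
      ⟨v, hv⟩ | ⟨a, ha0, ⟨j₀, hj₀, ha⟩, hsum⟩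
    · exact hasContinuation_of_exists_pos hBo hBc hB0 hg hc0 hc l S v.2 hv
    set D : Set E := {x | x ∈ B ∧ ∀ j ∈ S, 0 < l j x} with hD
    have hDo : IsOpen D := isOpen_setOf_forall_pos hBo l S
    have hlV : ∀ v ∈ V, (∑ j ∈ S, a j • l j) v = 0 := fun v hv => by
      simpa using hsum ⟨v, hv⟩
    have hlD : ∀ x ∈ D, (∑ j ∈ S, a j • l j) x ≠ 0 := by
      intro x hx
      rw [LinearMap.sum_apply]
      exact (Finset.sum_pos' (fun j hj => mul_nonneg (ha0 j hj) (hx.2 j hj).le)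
        ⟨j₀, hj₀, mul_pos ha (hx.2 j₀ hj₀)⟩).ne'
    refine HasContinuation.of_extend_mul hlV hlD ?_
    have hsub : ∀ j, D ⊆ {x | x ∈ B ∧ ∀ i ∈ S.erase j, 0 < l i x} := fun j x hx =>
      ⟨hx.1, fun i hi => hx.2 i (Finset.mem_of_mem_erase hi)⟩
    -- After multiplication by `∑ a j • l j` only the sets `S.erase j` remain, and these are covered
    -- by induction.
    have hcont := HasContinuation.sum S fun j hj =>
      ((ih (S.erase j) (Finset.erase_ssubset hj)).mono (hsub j)).const_mul (a j : ℂ)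
    refine hcont.congr fun z hz => ?_
    rw [← fiberIntegral_mul_left hlV, ← fiberIntegral_sum S (fun j => (a j : ℂ))
      (fun j _ => (hg.mono fun x (hx : x ∈ D) => hx.1).mul_prod_inv_extend hc0 (S.erase j)
        fun x hx => (hsub j hx).2) hc hDo hz]
    refine fiberIntegral_congr (D := D) (fun w hw => ?_) hz
    rw [mul_left_comm, extend_sum_smul, sum_mul_prod_inv_eq S _ _
      fun j hj => extend_ne_zero (hw.2 j hj).ne', Finset.mul_sum]
    exact Finset.sum_congr rfl fun j _ => by ring

end

/-! ### Signs on a chamber and expansion of the product. -/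

section

/-- Sufficiency is applied to the whole space as the subspace `⊤`, with the measure transported
there. -/
theorem IsSufficient.integrable_self {V : Type*} [NormedAddCommGroup V] [NormedSpace ℝ V]
    [MeasurableSpace V] [BorelSpace V] {c : V → ℝ} (hc : IsSufficient c)
    (μ : Measure V) [μ.IsAddHaarMeasure] : Integrable c μ := by
  let e : V ≃L[ℝ] (⊤ : Submodule ℝ V) :=
    ⟨Submodule.topEquiv.symm, continuous_id.subtype_mk _, continuous_subtype_val⟩
  have hm : (μ.map e).IsAddHaarMeasure := e.isAddHaarMeasure_map μ
  have h := hc.integrable ⊤ (μ.map e) 0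
  have h2 := (e.toHomeomorph.measurableEmbedding.integrable_map_iff).1 h
  exact h2.congr (ae_of_all _ fun x => congrArg c (zero_add x))

variable {E : Type*} [NormedAddCommGroup E] [NormedSpace ℝ E]

theorem extend_smul_left (a : ℝ) (l : Module.Dual ℝ E) (z : Complexification E) :
    extend (a • l) z = a * extend l z := by
  simp [extend]
  ring

/-- `∏ (l_j + 1) / l_j` as a linear combination of products of inverses of the forms `ε_j l_j`. -/
theorem prod_extend_add_one_div {ι : Type*} [Fintype ι] (l : ι → Module.Dual ℝ E)
    {ε : ι → ℝ} (hε : ∀ j, ε j ≠ 0) {z : Complexification E} (hz : ∀ j, extend (l j) z ≠ 0) :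
    ∏ j, (extend (l j) z + 1) / extend (l j) z =
      ∑ S ∈ (Finset.univ : Finset ι).powerset,
        (∏ j ∈ S, (ε j : ℂ)) * ∏ j ∈ S, (extend (ε j • l j) z)⁻¹ := by
  have h : ∀ j, (extend (l j) z + 1) / extend (l j) z = 1 + ε j * (extend (ε j • l j) z)⁻¹ := by
    intro j
    have h1 := hz j
    have h2 : (ε j : ℂ) ≠ 0 := Complex.ofReal_ne_zero.2 (hε j)
    rw [extend_smul_left]
    field_simp
  simp only [h, Finset.prod_one_add, Finset.prod_mul_distrib]

variable [FiniteDimensional ℝ E]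

/-- Intermediate value theorem: a change of sign would force a zero on `C`. -/
theorem IsPreconnected.sign_eq {C : Set E} (hC : IsPreconnected C)
    {l : Module.Dual ℝ E} (hl : ∀ x ∈ C, l x ≠ 0) {x y : E} (hx : x ∈ C) (hy : y ∈ C) :
    0 < (SignType.sign (l x) : ℝ) * l y := by
  have hcont : ContinuousOn l C := l.continuous_of_finiteDimensional.continuousOn
  rcases lt_or_gt_of_ne (hl x hx) with h | h
  · rw [sign_neg h]
    by_contra! hcon
    have hy' : 0 ≤ l y := by simpa using hcon
    obtain ⟨w, hw, hw0⟩ := hC.intermediate_value hx hy hcont ⟨h.le, hy'⟩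
    exact hl w hw hw0
  · rw [sign_pos h]
    by_contra! hcon
    have hy' : l y ≤ 0 := by simpa using hcon
    obtain ⟨w, hw, hw0⟩ := hC.intermediate_value hy hx hcont ⟨hy', h.le⟩
    exact hl w hw hw0

/-- On a chamber the forms have constant nonzero signs. -/
theorem IsChamber.exists_signs {B : Set E} {m : ℕ} {l : Fin m → Module.Dual ℝ E} {C : Set E}
    (hC : IsChamber B l C) :
    ∃ ε : Fin m → ℝ, (∀ j, ε j ≠ 0) ∧ C ⊆ {x | x ∈ B ∧ ∀ j ∈ Finset.univ, 0 < (ε j • l j) x} := by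
  obtain ⟨x, hx, rfl⟩ := hC
  have hsub := connectedComponentIn_subset (B \ ⋃ j, {y | l j y = 0}) x
  have hne : ∀ j, ∀ y ∈ connectedComponentIn (B \ ⋃ j, {y | l j y = 0}) x, l j y ≠ 0 :=
    fun j y hy h0 => (hsub hy).2 (Set.mem_iUnion.2 ⟨j, h0⟩)
  have hxC := mem_connectedComponentIn hx
  refine ⟨fun j => SignType.sign (l j x), fun j => ?_, fun y hy => ⟨(hsub hy).1, fun j _ => ?_⟩⟩
  · exact left_ne_zero_of_mul
      (isPreconnected_connectedComponentIn.sign_eq (hne j) hxC hxC).ne'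
  · simpa using isPreconnected_connectedComponentIn.sign_eq (hne j) hxC hy

end

end

/-! ### Assembly. -/

theorem theorem5p2 {E : Type*} [NormedAddCommGroup E] [NormedSpace ℝ E] [FiniteDimensional ℝ E]
    [MeasurableSpace E] [BorelSpace E]
    (V : Submodule ℝ E) (μ : MeasureTheory.Measure V) [μ.IsAddHaarMeasure]
    {m : ℕ} (l : Fin m → Module.Dual ℝ E) (hl : LinearIndependent ℝ l)
    (B : Set E) (hBopen : IsOpen B) (hBconvex : Convex ℝ B) (hB0 : (0 : E) ∈ B)
    (hBl : ∀ x ∈ B, ∀ j, -1 < l j x)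
    (f : Complexification E → ℂ) (hf : IsDistinguished B V l f)
    (C : Set E) (hC : IsChamber B l C) :
    (∀ z ∈ tube C, MeasureTheory.Integrable
      (fun v : V => f (z + Complex.I • ofReal (v : E))) μ) ∧
    DifferentiableOn ℂ (tubeIntegral V μ f) (tube C) ∧
    ∃ B' : Set E, IsOpen B' ∧ Convex ℝ B' ∧ (0 : E) ∈ B' ∧ C ⊆ B' ∧
      ∃ (m' : ℕ) (l' : Fin m' → Module.Dual ℝ E),
        (∀ j, ∀ v ∈ V, l' j v = 0) ∧
        (∃ F : Complexification E → ℂ, DifferentiableOn ℂ F (tube B') ∧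
          ∀ z ∈ tube C, F z = tubeIntegral V μ f z * ∏ j, extend (l' j) z) ∧
        ∀ j, {x | l' j x = 0} ∩ C = ∅ := by

  classical
  obtain ⟨-, g, hg, hfg, c, hc, hbound⟩ := hf
  have hcint : MeasureTheory.Integrable c μ := hc.integrable_self μ
  have hgdom : IsDominated V c B g := ⟨hg, hbound⟩
  obtain ⟨ε, hε, hCD⟩ := hC.exists_signs
  set D : Set E := {x | x ∈ B ∧ ∀ j ∈ Finset.univ, 0 < (ε j • l j) x} with hD
  have hDo : IsOpen D := isOpen_setOf_forall_pos hBopen _ _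
  have hsub : ∀ S : Finset (Fin m), D ⊆ {x | x ∈ B ∧ ∀ j ∈ S, 0 < (ε j • l j) x} :=
    fun S x hx => ⟨hx.1, fun j _ => hx.2 j (Finset.mem_univ j)⟩
  let H : Finset (Fin m) → Complexification E → ℂ := fun S z =>
    g z * ∏ j ∈ S, (extend (ε j • l j) z)⁻¹
  have hH : ∀ S, IsDominated V c D (H S) := fun S =>
    (hgdom.mono fun x hx => hx.1).mul_prod_inv_extend hc.nonneg S fun x hx => (hsub S hx).2
  have hf_eq : ∀ z ∈ tube D, f z =
      ∑ S ∈ (Finset.univ : Finset (Fin m)).powerset, (∏ j ∈ S, (ε j : ℂ)) * H S z := by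
    intro z hz
    have hne : ∀ j, extend (l j) z ≠ 0 := fun j => extend_ne_zero fun h0 => by
      have := hz.2 j (Finset.mem_univ j)
      simp [h0] at this
    -- Since `l j > -1` on `B`, the factor `l j + 1` has positive real part, so `f` can be recovered
    -- from `g`.
    have hne' : ∀ j, extend (l j) z + 1 ≠ 0 := fun j h0 => by
      have h1 := congrArg Complex.re h0
      rw [Complex.add_re, re_extend] at h1
      have := hBl z.re hz.1 j
      simp at h1
      linarith
    have h1 : f z = g z * ∏ j, (extend (l j) z + 1) / extend (l j) z := by
      rw [hfg z hz.1 hne, mul_assoc, ← Finset.prod_mul_distrib, Finset.prod_eq_one, mul_one]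
      intro j _
      have := hne j
      have := hne' j
      field_simp
    rw [h1, prod_extend_add_one_div l hε hne, Finset.mul_sum]
    exact Finset.sum_congr rfl fun S _ => mul_left_comm _ _ _
  have hint : ∀ z ∈ tube D, tubeIntegral V μ f z =
      1 / (2 * (Real.pi : ℂ)) ^ Module.finrank ℝ V *
        ∑ S ∈ (Finset.univ : Finset (Fin m)).powerset,
          (∏ j ∈ S, (ε j : ℂ)) * fiberIntegral V μ (H S) z := by
    intro z hz
    rw [← fiberIntegral_sum _ _ (fun S _ => hH S) hcint hDo hz,
      ← fiberIntegral_congr hf_eq hz]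
    rfl
  refine ⟨fun z hz => ?_, ?_, ?_⟩
  -- The whole fibre `z + iV` stays in the tube over `D`, so the expansion of `f` holds at every
  -- point of it.
  · simp only [fun v : V => hf_eq _ (IsDominated.add_mem_tube (hCD hz : z ∈ tube D) (v : E))]
    exact MeasureTheory.integrable_finsetSum _ fun S _ =>
      ((hH S).integrable hcint (hCD hz)).const_mul _
  · refine DifferentiableOn.mono (DifferentiableOn.congr ?_ hint) fun z hz => hCD hz
    exact (DifferentiableOn.fun_sum fun S _ =>
      ((hH S).differentiableOn_fiberIntegral hcint hDo).const_mul _).const_mul _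
  · have hcont : HasContinuation V D (tubeIntegral V μ f) :=
      ((HasContinuation.sum _ fun S _ => ((hasContinuation_fiberIntegral hBopen hBconvex hB0 hgdom
        hc.nonneg hcint (fun j => ε j • l j) S).mono (hsub S)).const_mul
          (∏ j ∈ S, (ε j : ℂ))).const_mul _).congr fun z hz => (hint z hz).symm
    obtain ⟨B', h1, h2, h3, h4, L, h5, h6, F, h7, h8⟩ := hcont.mono hCD
    refine ⟨B', h1, h2, h3, h4, L.length, L.get, fun j => h5 _ (L.get_mem j),
      ⟨F, h7, fun z hz => ?_⟩, fun j => ?_⟩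
    · rw [h8 z hz, ← List.prod_ofFn]
      congr 2
      conv_lhs => rw [← List.ofFn_get L, List.map_ofFn]
      rfl
    · exact Set.eq_empty_of_forall_notMem fun x hx => h6 _ (L.get_mem j) x hx.2 hx.1
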